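/- Let $k$ be an algebraically closed field of arbitrary characteristic. For integers $n,d\ge 0$ let $C_n(M_d)$ be the scheme of commuting $n$-tuples of $d\times d$ matrices over $k$, i.e. the closed subscheme of the affine space $M_d(k)^n$ cut out by the entries of all the commutators $x_ix_j-x_jx_i$. An irreducible component of $C_n(M_d)$ is called elementary if, for every tuple $(y_1,\dots,y_n)$ of commuting matrices belonging to it, each matrix $y_i$ has precisely one eigenvalue; otherwise it is called non-elementary. Let $d>4$ and let $(x_1,\dots,x_n)$ be an $n$-tuple of pairwise commuting nilpotent $d\times d$ matrices over $k$ such that some $k$-linear combination of $x_1,\dots,x_n$ has a two-dimensional kernel. Then $(x_1,\dots,x_n)$ belongs to a non-elementary irreducible component of $C_n(M_d)$. -/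

import Mathlib

/-- The coordinate ring `k[x_{i,a,b}]` of the affine space of `n`-tuples of `d × d` matrices:
the variable `(i, a, b)` is the entry in position `(a, b)` of the `i`-th matrix. -/
abbrev MatTupleRing (k : Type*) [Field k] (n d : ℕ) : Type _ :=
  MvPolynomial (Fin n × Fin d × Fin d) k

/-- The `i`-th generic matrix, whose entries are the variables. -/
noncomputable def genericMatrix (k : Type*) [Field k] (n d : ℕ) (i : Fin n) :
    Matrix (Fin d) (Fin d) (MatTupleRing k n d) :=
  Matrix.of fun a b => MvPolynomial.X (i, a, b)

/-- The ideal generated by all entries of all commutators `x_i x_j - x_j x_i`. -/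
noncomputable def commutatorIdeal (k : Type*) [Field k] (n d : ℕ) : Ideal (MatTupleRing k n d) :=
  Ideal.span {f | ∃ (i j : Fin n) (a b : Fin d),
    f = (genericMatrix k n d i * genericMatrix k n d j
      - genericMatrix k n d j * genericMatrix k n d i) a b}

/-- The coordinate ring of the scheme `C_n(M_d)`. -/
abbrev CommRingMat (k : Type*) [Field k] (n d : ℕ) : Type _ :=
  MatTupleRing k n d ⧸ commutatorIdeal k n d

/-- The (underlying topological space of the affine) scheme `C_n(M_d)`. -/
abbrev CommMat (k : Type*) [Field k] (n d : ℕ) : Type _ :=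
  PrimeSpectrum (CommRingMat k n d)

/-- Commuting `n`-tuples of `d × d` matrices over `k`, i.e. the `k`-points of `C_n(M_d)`. -/
abbrev CommTuple (k : Type*) [Field k] (n d : ℕ) : Type _ :=
  {x : Fin n → Matrix (Fin d) (Fin d) k // ∀ i j, x i * x j = x j * x i}

/-- Evaluation of a polynomial in the matrix entries at a tuple of matrices. -/
noncomputable def evalTuple {k : Type*} [Field k] {n d : ℕ}
    (x : Fin n → Matrix (Fin d) (Fin d) k) : MatTupleRing k n d →ₐ[k] k :=
  MvPolynomial.aeval fun p => x p.1 p.2.1 p.2.2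

theorem evalTuple_commutatorIdeal {k : Type*} [Field k] {n d : ℕ} (x : CommTuple k n d)
    (f : MatTupleRing k n d) (hf : f ∈ commutatorIdeal k n d) : evalTuple x.1 f = 0 := by
  have h : commutatorIdeal k n d ≤ RingHom.ker (evalTuple x.1) := by
    refine Ideal.span_le.2 ?_
    rintro _ ⟨i, j, a, b, rfl⟩
    have h1 := congrFun (congrFun (x.2 i j) a) b
    simp only [Matrix.mul_apply] at h1
    simp [RingHom.mem_ker, evalTuple, genericMatrix, Matrix.mul_apply, h1]
  exact h hf

/-- Evaluation at a commuting tuple, on the coordinate ring of `C_n(M_d)`. -/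
noncomputable def CommTuple.eval {k : Type*} [Field k] {n d : ℕ} (x : CommTuple k n d) :
    CommRingMat k n d →ₐ[k] k :=
  Ideal.Quotient.liftₐ (commutatorIdeal k n d) (evalTuple x.1) (evalTuple_commutatorIdeal x)

/-- The closed point of the scheme `C_n(M_d)` given by a commuting tuple: the maximal ideal of
the functions that vanish at the tuple. -/
noncomputable def CommTuple.point {k : Type*} [Field k] {n d : ℕ} (x : CommTuple k n d) :
    CommMat k n d :=
  ⟨RingHom.ker x.eval, RingHom.ker_isPrime x.eval⟩

/-- A subset (used for irreducible components) of `C_n(M_d)` is elementary if in every commuting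
tuple belonging to it each matrix has precisely one eigenvalue. -/
def IsElementary {k : Type*} [Field k] {n d : ℕ} (Z : Set (CommMat k n d)) : Prop :=
  ∀ x : CommTuple k n d, x.point ∈ Z →
    ∀ i : Fin n, ∃! μ : k, Module.End.HasEigenvalue (Matrix.toLin' (x.1 i)) μ

/-! Let `N` be a linear combination of the `x_i` with two-dimensional kernel. It is nilpotent with
at most two Jordan blocks, so `N` acts as multiplication by `t` on `k[t]/(t^(q+s)) × k[t]/(t^q)`
(`exists_equiv_of_finrank_ker`). Each `x_i` commutes with `N`, hence is a matrix `!![a_i, t^s b_i;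
c_i, a_i + f_i]` over `k[t]` (`exists_eq_pairEnd`), and these commute exactly when all `2 × 2`
minors of the vectors `v_i = (b_i, c_i, f_i)` vanish modulo `t^q` (`pairEnd_comm`,
`dvd_of_pairEnd_comm`).

Such vectors have the form `v_i = t^e (l_i w + t^(q-2e) z_i)` (`exists_eq_of_minors_dvd`). Replace
`t^e`, `t^(q-2e)`, `t^s` by monic polynomials `P`, `R`, `S` of the same degrees over `k[ε]`. The
minors of `P (l_i w + R z_i)` are divisible by `h = P^2 R`, so commuting matrices on `k[ε][t]/(hS) ×
k[ε][t]/(h)` result, still commuting with multiplication by `t`. The eigenvalues of the latter are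
the roots of `hS`. As `d > 4`, the degrees of `P`, `R`, `S` add up to at least 2, so one root can
move to `ε` while another stays at `0` (`exists_family_of_minors_dvd`).

Finally the tuple is corrected so that its linear combination is the deformed `N`
(`exists_not_isElementary_of_centralizer_family`). At `ε = 1` that combination has two eigenvalues,
which is impossible if every member of the commuting tuple has only one. The whole family lies in
one irreducible component because the affine line is irreducible. -/

open Polynomial

/-! ### One-parameter families in `C_n(M_d)` and matrices with one eigenvalue -/

/-- Two commuting tuples lying on a common family parametrized by the affine line belong to a
common irreducible component of `C_n(M_d)`. -/
theorem exists_irreducibleComponent_of_family {k : Type*} [Field k] {n d : ℕ}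
    (Y : Fin n → Matrix (Fin d) (Fin d) k[X]) (hY : ∀ i j, Y i * Y j = Y j * Y i)
    (x y : CommTuple k n d) (s t : k) (hx : ∀ i, (Y i).map (evalRingHom s) = x.1 i)
    (hy : ∀ i, (Y i).map (evalRingHom t) = y.1 i) :
    ∃ Z ∈ irreducibleComponents (CommMat k n d), x.point ∈ Z ∧ y.point ∈ Z := by
  let φ : MatTupleRing k n d →ₐ[k] k[X] := MvPolynomial.aeval fun p => Y p.1 p.2.1 p.2.2
  have hφ : ∀ f ∈ commutatorIdeal k n d, φ f = 0 := by
    have h : commutatorIdeal k n d ≤ RingHom.ker φ := by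
      refine Ideal.span_le.2 ?_
      rintro _ ⟨i, j, a, b, rfl⟩
      have h1 := congrFun (congrFun (hY i j) a) b
      simp only [Matrix.mul_apply] at h1
      simp [RingHom.mem_ker, φ, genericMatrix, Matrix.mul_apply, h1]
    exact fun f hf => h hf
  let ψ : CommRingMat k n d →ₐ[k] k[X] := Ideal.Quotient.liftₐ (commutatorIdeal k n d) φ hφ
  -- The image of the generic point of the line; it specializes to every member of the family, so
  -- any component containing it contains them all.
  let P : CommMat k n d := ⟨RingHom.ker ψ, RingHom.ker_isPrime ψ⟩
  have key : ∀ (z : CommTuple k n d) (s : k), (∀ i, (Y i).map (evalRingHom s) = z.1 i) →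
      P ⤳ z.point := by
    intro z s hz
    rw [← PrimeSpectrum.le_iff_specializes]
    have hcomp : (aeval s : k[X] →ₐ[k] k).comp φ = evalTuple z.1 := by
      refine MvPolynomial.algHom_ext fun p => ?_
      have := congrFun (congrFun (hz p.1) p.2.1) p.2.2
      simpa [φ, evalTuple, coe_aeval_eq_eval] using this
    intro f hf
    obtain ⟨f, rfl⟩ := Ideal.Quotient.mk_surjective f
    have h0 : φ f = 0 := hf
    change evalTuple z.1 f = 0
    rw [← hcomp, AlgHom.comp_apply, h0, map_zero]
  refine ⟨irreducibleComponent P, irreducibleComponent_mem_irreducibleComponents P, ?_, ?_⟩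
  · exact (key x s hx).mem_closed isClosed_irreducibleComponent mem_irreducibleComponent
  · exact (key y t hy).mem_closed isClosed_irreducibleComponent mem_irreducibleComponent

/-- Over an algebraically closed field, a matrix with exactly one eigenvalue is the sum of a scalar
matrix and a nilpotent one. -/
theorem Matrix.exists_isNilpotent_sub_scalar {k : Type*} [Field k] [IsAlgClosed k] {d : ℕ}
    (A : Matrix (Fin d) (Fin d) k)
    (h : ∃! μ : k, Module.End.HasEigenvalue (Matrix.toLin' A) μ) :
    ∃ μ : k, IsNilpotent (A - algebraMap k _ μ) := by
  obtain ⟨μ, -, hμ⟩ := h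
  refine ⟨μ, ?_⟩
  let f : Module.End k (Fin d → k) := Matrix.toLin' A
  -- The generalized eigenspaces span, and all but the one for `μ` vanish, so `f - μ` is nilpotent
  -- on the whole space.
  have htop := Module.End.iSup_maxGenEigenspace_eq_top f
  have hle : (⨆ ν : k, f.maxGenEigenspace ν) ≤
      f.maxGenEigenspace μ := by
    refine iSup_le fun ν => ?_
    by_cases hν : Module.End.HasEigenvalue f ν
    · rw [hμ ν hν]
    · have : f.maxGenEigenspace ν = ⊥ := by
        by_contra hne
        apply hν
        rw [Module.End.maxGenEigenspace_eq_genEigenspace_finrank] at hne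
        exact Module.End.hasEigenvalue_of_hasGenEigenvalue (k := Module.finrank k (Fin d → k)) hne
      rw [this]
      exact bot_le
  rw [htop, top_le_iff, Module.End.maxGenEigenspace_eq_genEigenspace_finrank,
    Module.End.genEigenspace_nat, LinearMap.ker_eq_top] at hle
  refine ⟨Module.finrank k (Fin d → k), ?_⟩
  apply (Matrix.toLinAlgEquiv' : Matrix (Fin d) (Fin d) k ≃ₐ[k] _).injective
  rw [map_pow, map_sub, map_zero, AlgEquiv.commutes]
  exact hle

/-- A sum of commuting elements that are nilpotent up to scalars is nilpotent up to a scalar. -/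
theorem exists_isNilpotent_sum_sub_algebraMap {k A ι : Type*} [Field k] [Ring A] [Algebra k A]
    (y : ι → A) (c : ι → k) (hcomm : ∀ i j, y i * y j = y j * y i)
    (h : ∀ i, ∃ μ : k, IsNilpotent (y i - algebraMap k A μ)) (s : Finset ι) :
    ∃ μ : k, IsNilpotent (∑ i ∈ s, c i • y i - algebraMap k A μ) := by
  choose μ hμ using h
  refine ⟨∑ i ∈ s, c i * μ i, ?_⟩
  have : ∑ i ∈ s, c i • y i - algebraMap k A (∑ i ∈ s, c i * μ i)
      = ∑ i ∈ s, c i • (y i - algebraMap k A (μ i)) := by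
    simp only [map_sum, Finset.sum_sub_distrib, map_mul, Algebra.smul_def, mul_sub]
  rw [this]
  refine Commute.isNilpotent_sum (fun i _ => (hμ i).smul _) fun i j _ _ => ?_
  refine Commute.smul_left (Commute.smul_right ?_ _) _
  exact ((show Commute (y i) (y j) from hcomm i j).sub_right (Algebra.commutes _ _).symm).sub_left
    (Algebra.commutes _ _)

/-! ### Vectors with minors vanishing modulo a power of `t` -/

/-- A family of vectors over `k[t]` whose pairwise `2 × 2` minors vanish modulo `t ^ q` is a family
of multiples of one vector up to powers of `t`. -/
theorem exists_eq_of_minors_dvd {k ι κ : Type*} [Field k] (q : ℕ) (v : ι → κ → k[X])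
    (h : ∀ i j a b, X ^ q ∣ v i a * v j b - v i b * v j a) :
    ∃ (e : ℕ) (l : ι → k[X]) (w : κ → k[X]) (z : ι → κ → k[X]), 2 * e ≤ q ∧
      ∀ i a, v i a = X ^ e * (l i * w a) + X ^ e * X ^ (q - 2 * e) * z i a := by
  by_cases hall : ∀ i a, X ^ (q - q / 2) ∣ v i a
  · choose z hz using hall
    -- For `e = q / 2` the exponent `e + (q - 2 * e)` is `q - q / 2`, so the remainder term alone
    -- suffices.
    refine ⟨q / 2, 0, 0, z, by omega, fun i a => ?_⟩
    rw [hz i a, ← pow_add, show q / 2 + (q - 2 * (q / 2)) = q - q / 2 by omega]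
    simp
  · classical
    have hex : ∃ m, ¬ ∀ i a, X ^ m ∣ v i a := ⟨_, hall⟩
    -- The exponent sought is `e = m - 1`, the largest power of `t` dividing all entries; some entry
    -- of the quotient `w` is then prime to `t`.
    obtain ⟨m, hm, hmin⟩ : ∃ m, (¬ ∀ i a, X ^ m ∣ v i a) ∧ ∀ m' < m, ∀ i a, X ^ m' ∣ v i a :=
      ⟨Nat.find hex, Nat.find_spec hex, fun m' hm' => not_not.1 (Nat.find_min hex hm')⟩
    have hle : m ≤ q - q / 2 := by
      by_contra hlt
      exact hall (hmin _ (by omega))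
    obtain ⟨e, rfl⟩ : ∃ e, m = e + 1 := by
      rcases m with _ | e
      · simp at hm
      · exact ⟨e, rfl⟩
    have hdiv := hmin e (by omega)
    choose w hw using hdiv
    push Not at hm
    obtain ⟨i₀, a₀, h₀⟩ := hm
    have hX : (X : k[X]) ≠ 0 := X_ne_zero
    have hcop : IsCoprime (w i₀ a₀) (X ^ (q - 2 * e)) := by
      refine IsCoprime.pow_right (IsCoprime.symm ?_)
      refine (irreducible_X.coprime_iff_not_dvd).2 fun hd => h₀ ?_
      rw [hw i₀ a₀, pow_succ]
      exact mul_dvd_mul_left _ hd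
    -- `r` inverts the entry `w i₀ a₀` modulo `t^(q-2e)`, so the minors through that entry make row
    -- `i` congruent to `r * w i a₀` times row `i₀`.
    obtain ⟨r, r', hr⟩ := hcop
    have hminor : ∀ i a, X ^ (q - 2 * e) ∣ w i a * w i₀ a₀ - w i a₀ * w i₀ a := by
      intro i a
      have h1 := h i i₀ a a₀
      rw [hw i a, hw i₀ a₀, hw i a₀, hw i₀ a] at h1
      have h2 : (X : k[X]) ^ (2 * e) * X ^ (q - 2 * e) ∣
          X ^ (2 * e) * (w i a * w i₀ a₀ - w i a₀ * w i₀ a) := by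
        rw [← pow_add, show 2 * e + (q - 2 * e) = q by omega]
        convert h1 using 1
        ring
      exact (mul_dvd_mul_iff_left (pow_ne_zero _ hX)).1 h2
    choose y hy using hminor
    refine ⟨e, fun i => r * w i a₀, fun a => w i₀ a, fun i a => r * y i a + r' * w i a,
      by omega, fun i a => ?_⟩
    rw [hw i a]
    linear_combination (-X ^ e * w i a) * hr + X ^ e * r * hy i a

/-! ### Endomorphisms of `K[t]/(hS) × K[t]/(h)` and their base change -/

/-- The quotient of the polynomial ring by the ideal generated by `g`. -/
abbrev PolyQuot {K : Type*} [CommRing K] (g : K[X]) : Type _ := K[X] ⧸ Ideal.span {g}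

namespace PolyQuot

variable {K : Type*} [CommRing K]

/-- The class of a polynomial. -/
noncomputable abbrev mk (g u : K[X]) : PolyQuot g := Ideal.Quotient.mk (Ideal.span {g}) u

theorem mk_eq_mk {g u v : K[X]} : mk g u = mk g v ↔ g ∣ u - v := by
  rw [Ideal.Quotient.mk_eq_mk_iff_sub_mem, Ideal.mem_span_singleton]

/-- Multiplication by `c`, as a map from `K[t]/(g)` to `K[t]/(h)`. -/
noncomputable def mulHom (g h c : K[X]) (H : h ∣ c * g) : PolyQuot g →ₗ[K[X]] PolyQuot h :=
  Submodule.mapQ (Ideal.span {g}) (Ideal.span {h}) (LinearMap.mulLeft K[X] c) (by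
    refine Submodule.span_le.2 ?_
    rintro _ rfl
    simpa [Ideal.mem_span_singleton] using H)

theorem mulHom_mk (g h c u : K[X]) (H : h ∣ c * g) : mulHom g h c H (mk g u) = mk h (c * u) := rfl

/-- The basis of `K[t]/(g)` consisting of the powers of `t`, for monic `g`. -/
noncomputable def basis {p : ℕ} (g : K[X]) (hg : g.Monic) (hp : g.natDegree = p) :
    Module.Basis (Fin p) K (PolyQuot g) :=
  Module.Basis.reindex (show Module.Basis (Fin g.natDegree) K (PolyQuot g) from
    AdjoinRoot.powerBasisAux' hg) (finCongr hp)

theorem basis_repr {p : ℕ} (g : K[X]) (hg : g.Monic) (hp : g.natDegree = p) (u : K[X]) (i : Fin p) :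
    (basis g hg hp).repr (mk g u) i = (u %ₘ g).coeff i := by
  subst hp
  rw [basis, Module.Basis.repr_reindex_apply]
  rfl

theorem basis_apply {p : ℕ} (g : K[X]) (hg : g.Monic) (hp : g.natDegree = p) (i : Fin p) :
    basis g hg hp i = mk g (X ^ (i : ℕ)) := by
  subst hp
  rw [basis, Module.Basis.reindex_apply]
  have h1 := (AdjoinRoot.powerBasis' hg).basis_eq_pow
  have h2 : (AdjoinRoot.powerBasisAux' hg) i = AdjoinRoot.root g ^ (i : ℕ) := h1 i
  refine h2.trans ?_
  rw [← AdjoinRoot.mk_X, ← map_pow]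
  rfl

/-- The endomorphism of `K[t]/(hS) × K[t]/(h)` with matrix `!![a, S b; c, a + f]`. -/
noncomputable def pairEnd (h S a b c f : K[X]) :
    Module.End K[X] (PolyQuot (h * S) × PolyQuot h) :=
  ((mulHom (h * S) (h * S) a (Dvd.intro_left _ rfl)).coprod
    (mulHom h (h * S) (S * b) ⟨b, by ring⟩)).prod
  ((mulHom (h * S) h c ⟨c * S, by ring⟩).coprod (mulHom h h (a + f) (Dvd.intro_left _ rfl)))

theorem pairEnd_mk (h S a b c f u v : K[X]) :
    pairEnd h S a b c f (mk _ u, mk _ v) =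
      (mk _ (a * u + S * b * v), mk _ (c * u + (a + f) * v)) := by
  simp [pairEnd, mulHom_mk]

/-- Subtracting the scalar `a` leaves `!![0, S b; c, f]`. In a commutator of two such matrices the
top row consists of `S` times minors, taken modulo `hS`, and the bottom row of combinations of
minors, taken modulo `h`. -/
theorem pairEnd_comm (h S a b c f a' b' c' f' : K[X]) (hbc : h ∣ b * c' - c * b')
    (hbf : h ∣ b * f' - f * b') (hcf : h ∣ c * f' - f * c') :
    pairEnd h S a b c f * pairEnd h S a' b' c' f' =
      pairEnd h S a' b' c' f' * pairEnd h S a b c f := by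
  obtain ⟨r₁, h₁⟩ := hbc
  obtain ⟨r₂, h₂⟩ := hbf
  obtain ⟨r₃, h₃⟩ := hcf
  refine LinearMap.ext fun ⟨u, v⟩ => ?_
  obtain ⟨u, rfl⟩ := Ideal.Quotient.mk_surjective u
  obtain ⟨v, rfl⟩ := Ideal.Quotient.mk_surjective v
  rw [Module.End.mul_apply, Module.End.mul_apply]
  refine (congrArg _ (pairEnd_mk h S a' b' c' f' u v)).trans
    (Eq.trans ?_ (congrArg _ (pairEnd_mk h S a b c f u v)).symm)
  rw [pairEnd_mk, pairEnd_mk]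
  refine Prod.ext (mk_eq_mk.2 ⟨r₁ * u + r₂ * v, ?_⟩) (mk_eq_mk.2 ⟨-r₃ * u - S * r₁ * v, ?_⟩)
  · linear_combination S * u * h₁ + S * v * h₂
  · linear_combination -u * h₃ - S * v * h₁

/-- The basis of `K[t]/(hS) × K[t]/(h)` consisting of the powers of `t`. -/
noncomputable def pairBasis {p q d : ℕ} (h S : K[X]) (hh : h.Monic) (hS : S.Monic)
    (hp : (h * S).natDegree = p) (hq : h.natDegree = q) (hd : p + q = d) :
    Module.Basis (Fin d) K (PolyQuot (h * S) × PolyQuot h) :=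
  ((basis (h * S) (hh.mul hS) hp).prod (basis h hh hq)).reindex
    (finSumFinEquiv.trans (finCongr hd))

/-- The matrix of `pairEnd` with respect to the basis `pairBasis`. -/
noncomputable def pairMatrix {p q d : ℕ} (h S : K[X]) (hh : h.Monic) (hS : S.Monic)
    (hp : (h * S).natDegree = p) (hq : h.natDegree = q) (hd : p + q = d) (a b c f : K[X]) :
    Matrix (Fin d) (Fin d) K :=
  LinearMap.toMatrixAlgEquiv (pairBasis h S hh hS hp hq hd)
    ((pairEnd h S a b c f).restrictScalars K)

theorem pairMatrix_comm {p q d : ℕ} (h S : K[X]) (hh : h.Monic) (hS : S.Monic)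
    (hp : (h * S).natDegree = p) (hq : h.natDegree = q) (hd : p + q = d)
    (a b c f a' b' c' f' : K[X]) (hbc : h ∣ b * c' - c * b')
    (hbf : h ∣ b * f' - f * b') (hcf : h ∣ c * f' - f * c') :
    pairMatrix h S hh hS hp hq hd a b c f * pairMatrix h S hh hS hp hq hd a' b' c' f' =
      pairMatrix h S hh hS hp hq hd a' b' c' f' * pairMatrix h S hh hS hp hq hd a b c f := by
  rw [pairMatrix, pairMatrix, ← map_mul, ← map_mul]
  congr 1
  exact congrArg (LinearMap.restrictScalars K) (pairEnd_comm h S a b c f a' b' c' f' hbc hbf hcf)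

/-- Remainders modulo a monic polynomial commute with ring homomorphisms. This allows the
deformation parameter to be specialized to `0` and to `1`. The images are separate variables tied by
equations, so that a specialization can be stated in simplified form, such as `X ^ q`. -/
theorem pairMatrix_map {L : Type*} [CommRing L] (σ : K →+* L) {p q d : ℕ} (h S : K[X])
    (hh : h.Monic) (hS : S.Monic)
    (hp : (h * S).natDegree = p) (hq : h.natDegree = q) (hd : p + q = d) (a b c f : K[X])
    {h' S' a' b' c' f' : L[X]} (hh' : h'.Monic) (hS' : S'.Monic)
    (hp' : (h' * S').natDegree = p) (hq' : h'.natDegree = q)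
    (eh : h.map σ = h') (eS : S.map σ = S') (ea : a.map σ = a') (eb : b.map σ = b')
    (ec : c.map σ = c') (ef : f.map σ = f') :
    (pairMatrix h S hh hS hp hq hd a b c f).map σ =
      pairMatrix h' S' hh' hS' hp' hq' hd a' b' c' f' := by
  subst eh eS ea eb ec ef
  subst hd
  have e1 : (h * S).map σ = h.map σ * S.map σ := Polynomial.map_mul σ
  ext i j
  obtain ⟨i, rfl⟩ := finSumFinEquiv.surjective i
  obtain ⟨j, rfl⟩ := finSumFinEquiv.surjective j
  rw [Matrix.map_apply, pairMatrix, pairMatrix, LinearMap.toMatrixAlgEquiv_apply,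
    LinearMap.toMatrixAlgEquiv_apply]
  have z1 : ∀ g : K[X], (0 : PolyQuot g) = mk g 0 := fun g => (map_zero _).symm
  have z2 : ∀ g : L[X], (0 : PolyQuot g) = mk g 0 := fun g => (map_zero _).symm
  have m1 : ∀ (u v : K[X]) (x : PolyQuot (h * S) × PolyQuot h), x = (mk _ u, mk _ v) →
    (pairEnd h S a b c f).restrictScalars K x =
      (mk _ (a * u + S * b * v), mk _ (c * u + (a + f) * v)) := by
    rintro u v _ rfl
    exact pairEnd_mk h S a b c f u v
  have m2 : ∀ (u v : L[X]) (x : PolyQuot (h.map σ * S.map σ) × PolyQuot (h.map σ)),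
    x = (mk _ u, mk _ v) →
    (pairEnd (h.map σ) (S.map σ) (a.map σ) (b.map σ) (c.map σ) (f.map σ)).restrictScalars L x =
      (mk _ (a.map σ * u + S.map σ * b.map σ * v),
        mk _ (c.map σ * u + (a.map σ + f.map σ) * v)) := by
    rintro u v _ rfl
    exact pairEnd_mk _ _ _ _ _ _ u v
  rcases j with j | j
  · rw [m1 (X ^ (j : ℕ)) 0 _ (by simp [pairBasis, basis_apply]),
      m2 (X ^ (j : ℕ)) 0 _ (by simp [pairBasis, basis_apply])]
    rcases i with i | i
    · simp only [pairBasis, Module.Basis.repr_reindex_apply, Equiv.symm_trans_apply,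
        finCongr_refl, Equiv.refl_symm,
        Equiv.refl_apply, Equiv.symm_apply_apply, Module.Basis.prod_repr_inl, basis_repr]
      rw [← coeff_map, map_modByMonic _ (hh.mul hS), e1]
      simp
    · simp only [pairBasis, Module.Basis.repr_reindex_apply, Equiv.symm_trans_apply,
        finCongr_refl, Equiv.refl_symm,
        Equiv.refl_apply, Equiv.symm_apply_apply, Module.Basis.prod_repr_inr, basis_repr]
      rw [← coeff_map, map_modByMonic _ hh]
      simp
  · rw [m1 0 (X ^ (j : ℕ)) _ (by simp [pairBasis, basis_apply]),
      m2 0 (X ^ (j : ℕ)) _ (by simp [pairBasis, basis_apply])]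
    rcases i with i | i
    · simp only [pairBasis, Module.Basis.repr_reindex_apply, Equiv.symm_trans_apply,
        finCongr_refl, Equiv.refl_symm,
        Equiv.refl_apply, Equiv.symm_apply_apply, Module.Basis.prod_repr_inl, basis_repr]
      rw [← coeff_map, map_modByMonic _ (hh.mul hS), e1]
      simp
    · simp only [pairBasis, Module.Basis.repr_reindex_apply, Equiv.symm_trans_apply,
        finCongr_refl, Equiv.refl_symm,
        Equiv.refl_apply, Equiv.symm_apply_apply, Module.Basis.prod_repr_inr, basis_repr]
      rw [← coeff_map, map_modByMonic _ hh]
      simp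

/-- If the matrix of multiplication by `t` on `K[t]/(hS) × K[t]/(h)` is the sum of the scalar `μ`
and a nilpotent matrix, then `μ` is the only root of `hS`. -/
theorem eq_of_isNilpotent_pairMatrix_sub [IsDomain K] {p q d : ℕ} (h S : K[X]) (hh : h.Monic)
    (hS : S.Monic) (hp : (h * S).natDegree = p) (hq : h.natDegree = q) (hd : p + q = d) {μ : K}
    (hμ : IsNilpotent (pairMatrix h S hh hS hp hq hd X 0 0 0 - algebraMap K _ μ))
    {r : K} (hr : (h * S).IsRoot r) : r = μ := by
  obtain ⟨m, hm⟩ := hμ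
  have hsmul : ∀ g u : K[X], μ • mk g u = mk g (C μ * u) := fun g u => by
    rw [← smul_eq_C_mul]
    rfl
  have h1 : pairMatrix h S hh hS hp hq hd X 0 0 0 - algebraMap K _ μ =
      pairMatrix h S hh hS hp hq hd (X - C μ) 0 0 0 := by
    rw [pairMatrix, pairMatrix, ← AlgEquiv.commutes
      (LinearMap.toMatrixAlgEquiv (pairBasis h S hh hS hp hq hd)), ← map_sub]
    congr 1
    refine LinearMap.ext fun ⟨u, v⟩ => ?_
    obtain ⟨u, rfl⟩ := Ideal.Quotient.mk_surjective u
    obtain ⟨v, rfl⟩ := Ideal.Quotient.mk_surjective v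
    rw [LinearMap.sub_apply, Module.algebraMap_end_apply]
    refine (congrArg (· - _) (pairEnd_mk h S X 0 0 0 u v)).trans
      (Eq.trans ?_ (pairEnd_mk h S (X - C μ) 0 0 0 u v).symm)
    refine Prod.ext ?_ ?_
    · change mk _ _ - μ • mk _ u = mk _ _
      rw [hsmul, ← map_sub]
      congr 1
      ring
    · change mk _ _ - μ • mk _ v = mk _ _
      rw [hsmul, ← map_sub]
      congr 1
      ring
  rw [h1, pairMatrix, ← map_pow, EmbeddingLike.map_eq_zero_iff] at hm
  -- Tracking the generator of the first factor is enough: once the power is zero, `hS` divides `(t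
  -- - μ)^m`, and evaluation at `r` gives `r = μ`.
  have h2 : ∀ m : ℕ, ((pairEnd h S (X - C μ) 0 0 0).restrictScalars K ^ m) (mk _ 1, mk _ 0) =
      (mk _ ((X - C μ) ^ m), mk _ 0) := by
    intro m
    induction m with
    | zero => simp
    | succ m ih =>
      rw [pow_succ', Module.End.mul_apply, ih]
      refine (pairEnd_mk h S (X - C μ) 0 0 0 _ _).trans ?_
      congr 2 <;> ring
  have h3 := h2 m
  rw [hm, LinearMap.zero_apply] at h3
  have h4 : mk (h * S) ((X - C μ) ^ m) = mk (h * S) 0 := by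
    exact (congrArg Prod.fst h3).symm.trans (map_zero _).symm
  rw [mk_eq_mk, sub_zero] at h4
  have h5 := hr.dvd h4
  rw [IsRoot.def, eval_pow] at h5
  simpa [sub_eq_zero] using eq_zero_of_pow_eq_zero h5

end PolyQuot

/-! ### Nilpotent operators with two Jordan blocks and their centralizers -/

namespace PolyQuot

/-- The kernel of a nilpotent operator has dimension at least the number of its Jordan blocks. -/
theorem card_blocks_le_finrank_ker {k V : Type*} [Field k] [AddCommGroup V] [Module k V]
    [FiniteDimensional k V] (N : Module.End k V) {m : ℕ} (r : Fin m → ℕ)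
    (φ : Module.AEval' N ≃ₗ[k[X]] (∀ i, PolyQuot ((X : k[X]) ^ r i))) :
    (Finset.univ.filter fun i => r i ≠ 0).card ≤ Module.finrank k (LinearMap.ker N) := by
  classical
  set S := Finset.univ.filter fun i => r i ≠ 0
  let ψ : V ≃ₗ[k] (∀ i, PolyQuot ((X : k[X]) ^ r i)) :=
    (Module.AEval'.of N).trans (φ.restrictScalars k)
  have hψ : ∀ v, ψ (N v) = (X : k[X]) • ψ v := fun v => by
    change φ (Module.AEval'.of N (N v)) = X • φ (Module.AEval'.of N v)
    rw [← map_smul, Module.AEval'.X_smul_of]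
  -- In each nontrivial block the class of `t^(r-1)` is nonzero and killed by `t`; these classes
  -- give independent vectors of the kernel.
  let E : S → ∀ i, PolyQuot ((X : k[X]) ^ r i) := fun j => Pi.single j.1 (mk _ (X ^ (r j.1 - 1)))
  have hE : ∀ j : S, (X : k[X]) • E j = 0 := fun j => by
    have hj : r j.1 ≠ 0 := (Finset.mem_filter.1 j.2).2
    change (X : k[X]) • Pi.single _ _ = _
    rw [← Pi.single_smul]
    have : (X : k[X]) • mk (X ^ r j.1) (X ^ (r j.1 - 1) : k[X]) = 0 := by
      change mk _ (X * X ^ (r j.1 - 1)) = 0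
      rw [← pow_succ', Nat.sub_add_cancel (Nat.pos_of_ne_zero hj)]
      exact Ideal.Quotient.eq_zero_iff_mem.2 (Ideal.mem_span_singleton_self _)
    rw [this, Pi.single_zero]
  have hker : ∀ j : S, ψ.symm (E j) ∈ LinearMap.ker N := fun j => by
    rw [LinearMap.mem_ker]
    apply ψ.injective
    rw [hψ, ψ.apply_symm_apply, hE, map_zero]
  have hli : LinearIndependent k fun j : S => (⟨ψ.symm (E j), hker j⟩ : LinearMap.ker N) := by
    rw [Fintype.linearIndependent_iff]
    intro g hg j
    have h1 := congrArg (fun v : LinearMap.ker N => ψ v.1 j.1) hg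
    have hj : r j.1 ≠ 0 := (Finset.mem_filter.1 j.2).2
    simp only [Submodule.coe_sum, Submodule.coe_smul, map_sum, map_smul, ψ.apply_symm_apply,
      Finset.sum_apply, Pi.smul_apply, ZeroMemClass.coe_zero, map_zero, Pi.zero_apply] at h1
    rw [Finset.sum_eq_single j] at h1
    · simp only [E, Pi.single_eq_same] at h1
      have h2 : mk (X ^ r j.1) (g j • (X : k[X]) ^ (r j.1 - 1)) = mk _ 0 := h1.trans (map_zero _).symm
      rw [mk_eq_mk, sub_zero, X_pow_dvd_iff] at h2
      simpa using h2 (r j.1 - 1) (by omega)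
    · intro i _ hij
      simp only [E]
      rw [Pi.single_eq_of_ne (fun h => hij (Subtype.ext h.symm)), smul_zero]
    · simp
  simpa using hli.fintype_card_le_finrank

theorem subsingleton_of_pow_zero {k : Type*} [Field k] {r : ℕ} (hr : r = 0) :
    Subsingleton (PolyQuot ((X : k[X]) ^ r)) := by
  subst hr
  rw [pow_zero]
  exact Ideal.Quotient.subsingleton_iff.2 Ideal.span_singleton_one

/-- A product of cyclic modules with at most two nontrivial factors. -/
theorem exists_equiv_prod {k : Type*} [Field k] {m : ℕ} (r : Fin m → ℕ)
    (h : (Finset.univ.filter fun i => r i ≠ 0).card ≤ 2) :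
    ∃ p q : ℕ, Nonempty ((∀ i, PolyQuot ((X : k[X]) ^ r i)) ≃ₗ[k[X]]
      PolyQuot ((X : k[X]) ^ p) × PolyQuot ((X : k[X]) ^ q)) := by
  classical
  have hbot : ∀ i, i ∉ Finset.univ.filter (fun i => r i ≠ 0) →
      Subsingleton (PolyQuot ((X : k[X]) ^ r i)) := fun i hi =>
    subsingleton_of_pow_zero (by simpa using hi)
  have h0 : Subsingleton (PolyQuot ((X : k[X]) ^ 0)) := subsingleton_of_pow_zero rfl
  interval_cases hc : (Finset.univ.filter fun i => r i ≠ 0).card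
  · rw [Finset.card_eq_zero] at hc
    rw [hc] at hbot
    have : ∀ i, Subsingleton (PolyQuot ((X : k[X]) ^ r i)) := fun i => hbot i (by simp)
    exact ⟨0, 0, ⟨0⟩⟩
  · obtain ⟨i, hi⟩ := Finset.card_eq_one.1 hc
    rw [hi] at hbot
    refine ⟨r i, 0, ⟨LinearEquiv.ofBijective ((LinearMap.proj i).prod 0) ⟨?_, ?_⟩⟩⟩
    · intro x y hxy
      ext j
      by_cases hj : j = i
      · subst hj
        exact congrArg Prod.fst hxy
      · have := hbot j (by simpa using hj)
        exact Subsingleton.elim _ _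
    · rintro ⟨u, v⟩
      exact ⟨Pi.single i u, Prod.ext (by simp) (Subsingleton.elim _ _)⟩
  · obtain ⟨i, j, hij, hi⟩ := Finset.card_eq_two.1 hc
    rw [hi] at hbot
    refine ⟨r i, r j, ⟨LinearEquiv.ofBijective
      ((LinearMap.proj i).prod (LinearMap.proj j)) ⟨?_, ?_⟩⟩⟩
    · intro x y hxy
      ext l
      by_cases hl : l = i
      · subst hl
        exact congrArg Prod.fst hxy
      by_cases hl' : l = j
      · subst hl'
        exact congrArg Prod.snd hxy
      · have := hbot l (by simp [hl, hl'])
        exact Subsingleton.elim _ _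
    · rintro ⟨u, v⟩
      exact ⟨Pi.single i u + Pi.single j v, by simp [hij, hij.symm]⟩

/-- A nilpotent operator with two-dimensional kernel has at most two Jordan blocks. -/
theorem exists_equiv_of_finrank_ker {k V : Type*} [Field k] [AddCommGroup V] [Module k V]
    [FiniteDimensional k V] (N : Module.End k V) (hN : IsNilpotent N)
    (h2 : Module.finrank k (LinearMap.ker N) = 2) :
    ∃ q s : ℕ, Nonempty (Module.AEval' N ≃ₗ[k[X]]
      PolyQuot ((X : k[X]) ^ q * X ^ s) × PolyQuot ((X : k[X]) ^ q)) := by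
  obtain ⟨m, hm⟩ := hN
  have htors : Module.IsTorsion' (Module.AEval' N) (Submonoid.powers (X : k[X])) := by
    intro v
    refine ⟨⟨X ^ m, m, rfl⟩, ?_⟩
    obtain ⟨v, rfl⟩ := (Module.AEval'.of N).surjective v
    change (X : k[X]) ^ m • Module.AEval'.of N v = 0
    rw [Module.AEval'.X_pow_smul_of, hm]
    simp
  -- Some exponents `r i` may be zero, so only the nonzero ones count as Jordan blocks.
  obtain ⟨l, r, ⟨φ⟩⟩ := Module.torsion_by_prime_power_decomposition irreducible_X htors
  let φ' : Module.AEval' N ≃ₗ[k[X]] (∀ i, PolyQuot ((X : k[X]) ^ r i)) :=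
    φ.trans (DirectSum.linearEquivFunOnFintype _ _ _)
  have hcard := card_blocks_le_finrank_ker N r φ'
  rw [h2] at hcard
  obtain ⟨p, q, ⟨χ⟩⟩ := exists_equiv_prod (k := k) r hcard
  rcases le_total q p with hqp | hqp
  · refine ⟨q, p - q, ?_⟩
    rw [← pow_add, Nat.add_sub_cancel' hqp]
    exact ⟨φ'.trans χ⟩
  · refine ⟨p, q - p, ?_⟩
    rw [← pow_add, Nat.add_sub_cancel' hqp]
    exact ⟨(φ'.trans χ).trans (LinearEquiv.prodComm _ _ _)⟩

/-- Every endomorphism of `K[t]/(hS) × K[t]/(h)` is of the form `pairEnd`. -/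
theorem exists_eq_pairEnd {K : Type*} [CommRing K] [IsDomain K] {h S : K[X]} (hh : h ≠ 0)
    (T : Module.End K[X] (PolyQuot (h * S) × PolyQuot h)) :
    ∃ a b c f : K[X], T = pairEnd h S a b c f := by
  obtain ⟨a, ha⟩ := Ideal.Quotient.mk_surjective (T (mk _ 1, mk _ 0)).1
  obtain ⟨c, hc⟩ := Ideal.Quotient.mk_surjective (T (mk _ 1, mk _ 0)).2
  obtain ⟨b', hb'⟩ := Ideal.Quotient.mk_surjective (T (mk _ 0, mk _ 1)).1
  obtain ⟨e, he⟩ := Ideal.Quotient.mk_surjective (T (mk _ 0, mk _ 1)).2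
  -- The generator of the second factor is killed by `h`, hence so is its image, which forces the
  -- first coordinate of the image to be a multiple of `S`.
  have hann : h • T (mk _ 0, mk _ 1) = 0 := by
    rw [← map_smul]
    have : h • ((mk (h * S) 0, mk h 1) : PolyQuot (h * S) × PolyQuot h) = 0 := by
      refine Prod.ext ?_ ?_
      · change mk _ (h * 0) = 0
        simp
      · change mk _ (h * 1) = 0
        exact Ideal.Quotient.eq_zero_iff_mem.2 (by simp)
    rw [this, map_zero]
  have h1 : mk (h * S) (h * b') = mk _ 0 := by
    have := congrArg Prod.fst hann
    rw [Prod.smul_fst, ← hb'] at this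
    exact this.trans (map_zero _).symm
  rw [mk_eq_mk, sub_zero] at h1
  obtain ⟨b, rfl⟩ := (mul_dvd_mul_iff_left hh).1 h1
  refine ⟨a, b, c, e - a, LinearMap.ext fun ⟨u, v⟩ => ?_⟩
  obtain ⟨u, rfl⟩ := Ideal.Quotient.mk_surjective u
  obtain ⟨v, rfl⟩ := Ideal.Quotient.mk_surjective v
  have h2 : ((mk (h * S) u, mk h v) : PolyQuot (h * S) × PolyQuot h) =
      u • (mk _ 1, mk _ 0) + v • (mk _ 0, mk _ 1) := by
    refine Prod.ext ?_ ?_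
    · change mk _ u = mk _ (u * 1 + v * 0)
      simp
    · change mk _ v = mk _ (u * 0 + v * 1)
      simp
  refine Eq.trans ?_ (pairEnd_mk h S a b c (e - a) u v).symm
  refine (congrArg T h2).trans ?_
  rw [map_add, map_smul, map_smul]
  refine Prod.ext ?_ ?_
  · rw [Prod.fst_add, Prod.smul_fst, Prod.smul_fst, ← ha, ← hb']
    change mk _ (u * a + v * (S * b)) = mk _ _
    congr 1
    ring
  · rw [Prod.snd_add, Prod.smul_snd, Prod.smul_snd, ← hc, ← he]
    change mk _ (u * c + v * e) = mk _ _
    congr 1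
    ring

/-- The conditions for two endomorphisms of `K[t]/(hS) × K[t]/(h)` to commute are necessary. -/
theorem dvd_of_pairEnd_comm {K : Type*} [CommRing K] [IsDomain K] {h S : K[X]} (hS : S ≠ 0)
    {a b c f a' b' c' f' : K[X]}
    (H : pairEnd h S a b c f * pairEnd h S a' b' c' f' =
      pairEnd h S a' b' c' f' * pairEnd h S a b c f) :
    h ∣ b * c' - c * b' ∧ h ∣ b * f' - f * b' ∧ h ∣ c * f' - f * c' := by
  have key : ∀ u v : K[X], pairEnd h S a b c f (pairEnd h S a' b' c' f' (mk _ u, mk _ v)) =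
      pairEnd h S a' b' c' f' (pairEnd h S a b c f (mk _ u, mk _ v)) := fun u v =>
    LinearMap.congr_fun H (mk _ u, mk _ v)
  simp only [pairEnd_mk, Prod.mk.injEq, mk_eq_mk] at key
  -- On the two generators, the first coordinates give `S` times a minor modulo `hS`, where `S`
  -- cancels; the second coordinate at `(1, 0)` gives the remaining minor up to sign.
  obtain ⟨h1, h2⟩ := key 1 0
  obtain ⟨h3, -⟩ := key 0 1
  refine ⟨?_, ?_, ?_⟩
  · rw [mul_comm h S] at h1
    refine (mul_dvd_mul_iff_left hS).1 (h1.trans (dvd_of_eq ?_))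
    ring
  · rw [mul_comm h S] at h3
    refine (mul_dvd_mul_iff_left hS).1 (h3.trans (dvd_of_eq ?_))
    ring
  · rw [← dvd_neg]
    refine h2.trans (dvd_of_eq ?_)
    ring

end PolyQuot

/-! ### From families to non-elementary components -/

/-- A tuple in a family of commuting tuples, up to a constant change of basis, lies in a
non-elementary component as soon as some linear combination of the members of the family has
several eigenvalues. -/
theorem exists_not_isElementary_of_family {k : Type*} [Field k] [IsAlgClosed k] {n d : ℕ}
    (x : CommTuple k n d) (U V : Matrix (Fin d) (Fin d) k) (hVU : V * U = 1)
    (Y : Fin n → Matrix (Fin d) (Fin d) k[X]) (hY : ∀ i j, Y i * Y j = Y j * Y i)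
    (hx : ∀ i, x.1 i = U * (Y i).map (evalRingHom 0) * V) (c : Fin n → k)
    (hc : ¬ ∃ μ : k, IsNilpotent (∑ i, c i • (Y i).map (evalRingHom 1) - algebraMap k _ μ)) :
    ∃ Z ∈ irreducibleComponents (CommMat k n d), x.point ∈ Z ∧ ¬ IsElementary Z := by
  have hUV : U * V = 1 := mul_eq_one_comm.1 hVU
  have hcomm : ∀ s i j, (Y i).map (evalRingHom s) * (Y j).map (evalRingHom s) =
      (Y j).map (evalRingHom s) * (Y i).map (evalRingHom s) := fun s i j => by
    rw [← Matrix.map_mul, ← Matrix.map_mul, hY]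
  have hconj : ∀ A B : Matrix (Fin d) (Fin d) k, (U * A * V) * (U * B * V) = U * (A * B) * V := by
    intro A B
    calc (U * A * V) * (U * B * V) = U * A * (V * U) * B * V := by simp only [mul_assoc]
      _ = _ := by rw [hVU]; simp only [mul_assoc, mul_one]
  let y : CommTuple k n d := ⟨fun i => U * (Y i).map (evalRingHom 1) * V, fun i j => by
    rw [hconj, hconj, hcomm]⟩
  have hUVC : V.map C * U.map C = 1 := by
    rw [← Matrix.map_mul, hVU, Matrix.map_one _ (map_zero _) (map_one _)]
  have hev : ∀ (s : k) (A : Matrix (Fin d) (Fin d) k), (A.map C).map (evalRingHom s) = A := by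
    intro s A
    ext i j
    simp
  obtain ⟨Z, hZ, hxZ, hyZ⟩ := exists_irreducibleComponent_of_family
    (fun i => U.map C * Y i * V.map C) (fun i j => by
      calc (U.map C * Y i * V.map C) * (U.map C * Y j * V.map C)
          = U.map C * Y i * (V.map C * U.map C) * Y j * V.map C := by simp only [mul_assoc]
        _ = U.map C * Y j * (V.map C * U.map C) * Y i * V.map C := by
          rw [hUVC, mul_one, mul_one, mul_assoc _ (Y i), hY, mul_assoc _ (Y j)]
        _ = _ := by simp only [mul_assoc]) x y 0 1
    (fun i => by rw [Matrix.map_mul, Matrix.map_mul, hev, hev, hx])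
    (fun i => by rw [Matrix.map_mul, Matrix.map_mul, hev, hev])
  -- In an elementary component every matrix of the tuple at `ε = 1` would be scalar plus nilpotent,
  -- and so would be any linear combination, as these matrices commute.
  refine ⟨Z, hZ, hxZ, fun hel => hc ?_⟩
  refine exists_isNilpotent_sum_sub_algebraMap (fun i => (Y i).map (evalRingHom 1)) c (hcomm 1)
    (fun i => ?_) Finset.univ
  obtain ⟨μ, m, hm⟩ := Matrix.exists_isNilpotent_sub_scalar _ (hel y hyZ i)
  refine ⟨μ, m, ?_⟩
  have h1 : ∀ r : ℕ, U * ((Y i).map (evalRingHom 1) - algebraMap k _ μ) ^ r * V =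
      (y.1 i - algebraMap k _ μ) ^ r := by
    intro r
    induction r with
    | zero => simp [hUV]
    | succ r ih =>
      rw [pow_succ, ← hconj, ih, pow_succ, mul_sub, sub_mul, ← Algebra.commutes, mul_assoc _ U V,
        hUV, mul_one]
  have h2 := h1 m
  rw [hm] at h2
  calc _ = (V * U) * ((Y i).map (evalRingHom 1) - algebraMap k _ μ) ^ m * (V * U) := by
        rw [hVU, one_mul, mul_one]
    _ = V * (U * ((Y i).map (evalRingHom 1) - algebraMap k _ μ) ^ m * V) * U := by
        simp only [mul_assoc]
    _ = 0 := by rw [h2, mul_zero, zero_mul]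

/-- A variant of `exists_not_isElementary_of_family` for a family of matrices that commute with a
given deformation of a linear combination of the members of the tuple. -/
theorem exists_not_isElementary_of_centralizer_family {k : Type*} [Field k] [IsAlgClosed k]
    {n d : ℕ} (x : CommTuple k n d) (U V : Matrix (Fin d) (Fin d) k) (hVU : V * U = 1)
    (Y : Fin n → Matrix (Fin d) (Fin d) k[X]) (hY : ∀ i j, Y i * Y j = Y j * Y i)
    (hx : ∀ i, x.1 i = U * (Y i).map (evalRingHom 0) * V) (c : Fin n → k) (hc : c ≠ 0)
    (N : Matrix (Fin d) (Fin d) k[X]) (hN : ∀ i, N * Y i = Y i * N)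
    (hN₀ : N.map (evalRingHom 0) = ∑ i, c i • (Y i).map (evalRingHom 0))
    (hN₁ : ¬ ∃ μ : k, IsNilpotent (N.map (evalRingHom 1) - algebraMap k _ μ)) :
    ∃ Z ∈ irreducibleComponents (CommMat k n d), x.point ∈ Z ∧ ¬ IsElementary Z := by
  classical
  obtain ⟨i₀, hi₀⟩ := Function.ne_iff.1 hc
  -- `D` vanishes at `ε = 0` and commutes with every `Y i`. Since `∑ c_i δ_i = 1`, passing to `Y i +
  -- δ_i D` keeps the tuple at `0` and turns the linear combination into `N`.
  let D : Matrix (Fin d) (Fin d) k[X] := N - ∑ j, C (c j) • Y j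
  let δ : Fin n → k := Pi.single i₀ (c i₀)⁻¹
  have hδ : ∑ i, c i * δ i = 1 := by
    rw [Finset.sum_eq_single i₀ (fun j _ hj => by simp [δ, hj]) (by simp)]
    simpa [δ] using mul_inv_cancel₀ hi₀
  have hDY : ∀ i, Commute D (Y i) := fun i =>
    Commute.sub_left (hN i) (Commute.sum_left _ _ _ fun j _ => Commute.smul_left (hY j i) _)
  have hev : ∀ (s : k) (r : k) (A : Matrix (Fin d) (Fin d) k[X]),
      (C r • A).map (evalRingHom s) = r • A.map (evalRingHom s) := by
    intro s r A
    ext i j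
    simp
  have hsum : ∀ (s : k) (A : Fin n → Matrix (Fin d) (Fin d) k[X]),
      (∑ i, A i).map (evalRingHom s) = ∑ i, (A i).map (evalRingHom s) := fun s A =>
    map_sum (evalRingHom s).mapMatrix A _
  have hadd : ∀ (s : k) (A B : Matrix (Fin d) (Fin d) k[X]),
      (A + B).map (evalRingHom s) = A.map (evalRingHom s) + B.map (evalRingHom s) := fun s A B =>
    map_add (evalRingHom s).mapMatrix A B
  have hsub : ∀ (s : k) (A B : Matrix (Fin d) (Fin d) k[X]),
      (A - B).map (evalRingHom s) = A.map (evalRingHom s) - B.map (evalRingHom s) := fun s A B =>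
    map_sub (evalRingHom s).mapMatrix A B
  have hD₀ : D.map (evalRingHom 0) = 0 := by
    rw [hsub, hN₀, hsum, sub_eq_zero]
    exact Finset.sum_congr rfl fun i _ => (hev 0 _ _).symm
  refine exists_not_isElementary_of_family x U V hVU (fun i => Y i + C (δ i) • D) ?_ ?_ c ?_
  · intro i j
    exact Commute.add_left
      (Commute.add_right (hY i j) ((hDY i).symm.smul_right _))
      (Commute.add_right ((hDY j).smul_left _) (((Commute.refl D).smul_left _).smul_right _))
  · intro i
    rw [hadd, hev, hD₀, smul_zero, add_zero, hx]
  · convert hN₁ using 6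
    have h1 : N = D + ∑ j, C (c j) • Y j := (sub_add_cancel _ _).symm
    conv_rhs => rw [h1, hadd, hsum]
    simp only [hadd, hev, smul_add, Finset.sum_add_distrib, smul_smul]
    rw [← Finset.sum_smul, hδ, one_smul, add_comm]

/-! ### The deformation that splits the eigenvalue `0` -/

/-- The monic polynomial `t ^ (e - i) (t - ε) ^ i` over `k[ε]`. -/
noncomputable def splitPow (k : Type*) [Field k] (e i : ℕ) : k[X][X] :=
  X ^ (e - i) * (X - C X) ^ i

namespace splitPow

variable {k : Type*} [Field k] {e i : ℕ}

theorem monic (e i : ℕ) : (splitPow k e i).Monic :=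
  (monic_X_pow _).mul ((monic_X_sub_C _).pow _)

theorem map_eval_zero (hi : i ≤ e) : (splitPow k e i).map (evalRingHom 0) = X ^ e := by
  simp [splitPow, ← pow_add, hi]

theorem isRoot_zero (hi : i < e) : ((splitPow k e i).map (evalRingHom 1)).IsRoot 0 := by
  simp [splitPow, IsRoot.def, show e - i ≠ 0 by omega]

theorem isRoot_one (hi : i ≠ 0) : ((splitPow k e i).map (evalRingHom 1)).IsRoot 1 := by
  simp [splitPow, IsRoot.def, hi]

end splitPow

open PolyQuot

/-- Commuting matrices in the centralizer of a nilpotent matrix with two Jordan blocks deform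
together with it in such a way that it acquires two eigenvalues. -/
theorem exists_family_of_minors_dvd {k ι : Type*} [Field k] {q s d : ℕ} (hqs : 3 ≤ q + s)
    (hp : ((X : k[X]) ^ q * X ^ s).natDegree = q + s) (hq : ((X : k[X]) ^ q).natDegree = q)
    (hd : (q + s) + q = d) (a b c f : ι → k[X])
    (hbc : ∀ i j, X ^ q ∣ b i * c j - c i * b j) (hbf : ∀ i j, X ^ q ∣ b i * f j - f i * b j)
    (hcf : ∀ i j, X ^ q ∣ c i * f j - f i * c j) :
    ∃ (Y : ι → Matrix (Fin d) (Fin d) k[X]) (N : Matrix (Fin d) (Fin d) k[X]),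
      (∀ i j, Y i * Y j = Y j * Y i) ∧ (∀ i, N * Y i = Y i * N) ∧
      (∀ i, (Y i).map (evalRingHom 0) = pairMatrix (X ^ q) (X ^ s) (monic_X_pow _) (monic_X_pow _)
        hp hq hd (a i) (b i) (c i) (f i)) ∧
      N.map (evalRingHom 0) = pairMatrix (X ^ q) (X ^ s) (monic_X_pow _) (monic_X_pow _)
        hp hq hd X 0 0 0 ∧
      ¬ ∃ μ : k, IsNilpotent (N.map (evalRingHom 1) - algebraMap k _ μ) := by
  obtain ⟨e, l, w, z, he, hv⟩ := exists_eq_of_minors_dvd q (fun i => ![b i, c i, f i]) (by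
    intro i j α β
    have e1 := hbc i j
    have e2 := hbf i j
    have e3 := hcf i j
    fin_cases α <;> fin_cases β
    · simp
    · simpa using e1
    · simpa using e2
    · rw [← dvd_neg]; simpa using e1
    · simp
    · simpa using e3
    · rw [← dvd_neg]; simpa using e2
    · rw [← dvd_neg]; simpa using e3
    · simp)
  -- The numbers of roots of `P`, `R`, `S` moved from `0` to `ε`: at least one must move and at
  -- least one must stay. For `e ≠ 0`, moving one root of `P` fails only if `e = 1`, `q = 2`, `s =
  -- 0`, which `3 ≤ q + s` excludes.
  obtain ⟨i₁, i₂, i₃, h₁, h₂, h₃, hne, hlt⟩ : ∃ i₁ i₂ i₃, i₁ ≤ e ∧ i₂ ≤ q - 2 * e ∧ i₃ ≤ s ∧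
      (i₁ ≠ 0 ∨ i₂ ≠ 0 ∨ i₃ ≠ 0) ∧ (i₁ < e ∨ i₂ < q - 2 * e ∨ i₃ < s) := by
    by_cases H : e = 0
    · by_cases H' : q = 0
      · exact ⟨0, 0, 1, by omega, by omega, by omega, by omega, by omega⟩
      · exact ⟨0, 1, 0, by omega, by omega, by omega, by omega, by omega⟩
    · exact ⟨1, 0, 0, by omega, by omega, by omega, by omega, by omega⟩
  set P := splitPow k e i₁
  set R := splitPow k (q - 2 * e) i₂
  set S := splitPow k s i₃
  have hP : P.Monic := splitPow.monic _ _
  have hR : R.Monic := splitPow.monic _ _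
  have hS : S.Monic := splitPow.monic _ _
  have hh : (P ^ 2 * R).Monic := (hP.pow 2).mul hR
  have hP₀ : P.map (evalRingHom 0) = X ^ e := splitPow.map_eval_zero h₁
  have hR₀ : R.map (evalRingHom 0) = X ^ (q - 2 * e) := splitPow.map_eval_zero h₂
  have hS₀ : S.map (evalRingHom 0) = X ^ s := splitPow.map_eval_zero h₃
  have hh₀ : (P ^ 2 * R).map (evalRingHom 0) = X ^ q := by
    rw [Polynomial.map_mul, Polynomial.map_pow, hP₀, hR₀, ← pow_mul, ← pow_add]
    congr 1
    omega
  have hqd : (P ^ 2 * R).natDegree = q := by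
    rw [← hh.natDegree_map (evalRingHom (0 : k)), hh₀, hq]
  have hpd : (P ^ 2 * R * S).natDegree = q + s := by
    rw [← (hh.mul hS).natDegree_map (evalRingHom (0 : k)), Polynomial.map_mul, hh₀, hS₀, hp]
  -- The outer variable is `t`, the inner one `ε`. Only the powers of `t` are deformed; `l`, `w`,
  -- `z` stay constant in `ε`.
  let v : Fin 3 → ι → k[X][X] := fun α i =>
    P * ((l i).map C * (w α).map C) + P * R * (z i α).map C
  have hmap : ∀ u : k[X], (u.map C).map (evalRingHom (0 : k)) = u := fun u => by
    rw [Polynomial.map_map]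
    have : (evalRingHom (0 : k)).comp C = RingHom.id k := by ext; simp
    rw [this, Polynomial.map_id]
  have hv₀ : ∀ α i, (v α i).map (evalRingHom 0) = ![b i, c i, f i] α := fun α i => by
    simp only [v, Polynomial.map_add, Polynomial.map_mul, hP₀, hR₀, hmap, hv]
  -- The `P ^ 2` terms without `R` come from the rank-one part `l_i w` and cancel.
  have hminor : ∀ α β i j, P ^ 2 * R ∣ v α i * v β j - v β i * v α j := fun α β i j =>
    ⟨(l i).map C * (w α).map C * (z j β).map C + (z i α).map C * (l j).map C * (w β).map C
      + R * (z i α).map C * (z j β).map C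
      - (l i).map C * (w β).map C * (z j α).map C - (z i β).map C * (l j).map C * (w α).map C
      - R * (z i β).map C * (z j α).map C, by
        simp only [v]
        ring⟩
  refine ⟨fun i => pairMatrix (P ^ 2 * R) S hh hS hpd hqd hd ((a i).map C) (v 0 i) (v 1 i) (v 2 i),
    pairMatrix (P ^ 2 * R) S hh hS hpd hqd hd X 0 0 0, fun i j => ?_, fun i => ?_, fun i => ?_, ?_,
    ?_⟩
  · exact pairMatrix_comm _ _ hh hS hpd hqd hd _ _ _ _ _ _ _ _ (hminor _ _ _ _) (hminor _ _ _ _)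
      (hminor _ _ _ _)
  · exact pairMatrix_comm _ _ hh hS hpd hqd hd _ _ _ _ _ _ _ _ (by simp) (by simp) (by simp)
  · exact pairMatrix_map _ _ _ hh hS hpd hqd hd _ _ _ _ _ _ _ _ hh₀ hS₀ (hmap _) (hv₀ 0 i) (hv₀ 1 i)
      (hv₀ 2 i)
  · exact pairMatrix_map _ _ _ hh hS hpd hqd hd _ _ _ _ _ _ _ _ hh₀ hS₀ (map_X _)
      (Polynomial.map_zero _) (Polynomial.map_zero _) (Polynomial.map_zero _)
  · rintro ⟨μ, hμ⟩
    have hq₁ : ((P ^ 2 * R).map (evalRingHom (1 : k))).natDegree = q := by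
      rw [hh.natDegree_map, hqd]
    have hp₁ : ((P ^ 2 * R).map (evalRingHom (1 : k)) * S.map (evalRingHom 1)).natDegree
        = q + s := by
      rw [← Polynomial.map_mul, (hh.mul hS).natDegree_map, hpd]
    rw [pairMatrix_map (evalRingHom (1 : k)) _ _ hh hS hpd hqd hd X 0 0 0 (hh.map _) (hS.map _)
      hp₁ hq₁ rfl rfl (map_X _) (Polynomial.map_zero _) (Polynomial.map_zero _)
      (Polynomial.map_zero _)] at hμ
    have hroot : ∀ r : k, ((P.map (evalRingHom 1)).IsRoot r ∨ (R.map (evalRingHom 1)).IsRoot r ∨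
        (S.map (evalRingHom 1)).IsRoot r) → r = μ := fun r hr =>
      eq_of_isNilpotent_pairMatrix_sub _ _ (hh.map _) (hS.map _) hp₁ hq₁ hd hμ (by
        rw [Polynomial.map_mul, Polynomial.map_pow, IsRoot.def, eval_mul, eval_mul, eval_pow]
        rcases hr with hr | hr | hr <;> rw [IsRoot.def] at hr <;> simp [hr])
    have r₀ : (0 : k) = μ := hroot 0 (hlt.imp splitPow.isRoot_zero
      (Or.imp splitPow.isRoot_zero splitPow.isRoot_zero))
    have r₁ : (1 : k) = μ := hroot 1 (hne.imp splitPow.isRoot_one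
      (Or.imp splitPow.isRoot_one splitPow.isRoot_one))
    exact zero_ne_one (r₀.trans r₁.symm)

/-! ### Proof of the main theorem -/

theorem mainTheorem10 {k : Type*} [Field k] [IsAlgClosed k] (n d : ℕ) (hd : 4 < d)
    (x : CommTuple k n d) (hnil : ∀ i, IsNilpotent (x.1 i))
    (hker : ∃ c : Fin n → k,
      Module.finrank k (LinearMap.ker (Matrix.toLin' (∑ i, c i • x.1 i))) = 2) :
    ∃ Z ∈ irreducibleComponents (CommMat k n d), x.point ∈ Z ∧ ¬ IsElementary Z := by
  obtain ⟨c, hc⟩ := hker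
  have hc0 : c ≠ 0 := by
    rintro rfl
    have h0 : ∑ i, (0 : Fin n → k) i • x.1 i = 0 := by simp
    rw [h0, map_zero, LinearMap.ker_zero, finrank_top, Module.finrank_fin_fun] at hc
    omega
  let N : Module.End k (Fin d → k) := Matrix.toLin' (∑ i, c i • x.1 i)
  have hN : IsNilpotent N := by
    have h1 : IsNilpotent (∑ i, c i • x.1 i) :=
      Commute.isNilpotent_sum (fun i _ => (hnil i).smul _) fun i j _ _ =>
        Commute.smul_left (Commute.smul_right (x.2 i j) _) _
    exact h1.map (Matrix.toLinAlgEquiv' : Matrix (Fin d) (Fin d) k ≃ₐ[k] _)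
  obtain ⟨q, s, ⟨φ⟩⟩ := exists_equiv_of_finrank_ker N hN hc
  have hp : ((X : k[X]) ^ q * X ^ s).natDegree = q + s := by rw [← pow_add, natDegree_X_pow]
  have hq : ((X : k[X]) ^ q).natDegree = q := natDegree_X_pow q
  let ψ : (Fin d → k) ≃ₗ[k] PolyQuot ((X : k[X]) ^ q * X ^ s) × PolyQuot ((X : k[X]) ^ q) :=
    (Module.AEval'.of N).trans (φ.restrictScalars k)
  have hψ : ∀ v, ψ (N v) = (X : k[X]) • ψ v := fun v => by
    change φ (Module.AEval'.of N (N v)) = X • φ (Module.AEval'.of N v)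
    rw [← map_smul, Module.AEval'.X_smul_of]
  have hdim : (q + s) + q = d := by
    have h1 := Module.finrank_eq_card_basis
      (pairBasis ((X : k[X]) ^ q) (X ^ s) (monic_X_pow _) (monic_X_pow _) hp hq rfl)
    rw [← ψ.finrank_eq] at h1
    simpa using h1.symm
  have hxN : ∀ i v, Matrix.toLin' (x.1 i) (N v) = N (Matrix.toLin' (x.1 i) v) := fun i v => by
    have h1 : x.1 i * (∑ j, c j • x.1 j) = (∑ j, c j • x.1 j) * x.1 i :=
      Commute.sum_right _ _ _ fun j _ => Commute.smul_right (x.2 i j) _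
    simp only [N]
    rw [← Matrix.toLin'_mul_apply, ← Matrix.toLin'_mul_apply, h1]
  -- Commuting with `N` means being `k[t]`-linear for the module structure in which `t` acts as `N`.
  let T : Fin n → Module.End k[X] (PolyQuot ((X : k[X]) ^ q * X ^ s) × PolyQuot ((X : k[X]) ^ q)) :=
    fun i => (LinearMap.ofAEval N (ψ.toLinearMap ∘ₗ Matrix.toLin' (x.1 i)) (fun v => by
      change ψ (Matrix.toLin' (x.1 i) (N v)) = X • ψ (Matrix.toLin' (x.1 i) v)
      rw [hxN, hψ])) ∘ₗ φ.symm.toLinearMap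
  have hT : ∀ i v, T i (ψ v) = ψ (Matrix.toLin' (x.1 i) v) := fun i v => by
    exact congrArg (fun w => ψ (Matrix.toLin' (x.1 i) w)) (ψ.symm_apply_apply v)
  choose a b γ f hT' using fun i => exists_eq_pairEnd (pow_ne_zero q X_ne_zero) (T i)
  have hTT : ∀ i j, T i * T j = T j * T i := fun i j => by
    refine LinearMap.ext fun v => ?_
    obtain ⟨v, rfl⟩ := ψ.surjective v
    rw [Module.End.mul_apply, Module.End.mul_apply, hT, hT, hT, hT, ← Matrix.toLin'_mul_apply,
      ← Matrix.toLin'_mul_apply, x.2 i j]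
  have hdvd := fun i j => dvd_of_pairEnd_comm (pow_ne_zero s X_ne_zero)
    (((congrArg₂ (· * ·) (hT' i) (hT' j)).symm.trans (hTT i j)).trans
      (congrArg₂ (· * ·) (hT' j) (hT' i)))
  -- The bound `3 ≤ q + s` follows from `2 (q + s) ≥ 2 q + s = d > 4`; this is where `d > 4` is
  -- essential.
  obtain ⟨Y, M, hY, hMY, hY₀, hM₀, hM₁⟩ := exists_family_of_minors_dvd (by omega) hp hq hdim a b γ f
    (fun i j => (hdvd i j).1) (fun i j => (hdvd i j).2.1) (fun i j => (hdvd i j).2.2)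
  let B := pairBasis ((X : k[X]) ^ q) (X ^ s) (monic_X_pow _) (monic_X_pow _) hp hq hdim
  have hY₀' : ∀ i, (Y i).map (evalRingHom 0) = LinearMap.toMatrix B B ((T i).restrictScalars k) :=
    fun i => by rw [hY₀, hT']; rfl
  let E := Pi.basisFun k (Fin d)
  refine exists_not_isElementary_of_centralizer_family x
    (LinearMap.toMatrix B E ψ.symm.toLinearMap) (LinearMap.toMatrix E B ψ.toLinearMap) ?_ Y hY ?_
    c hc0 M hMY ?_ hM₁
  · rw [← LinearMap.toMatrix_comp]
    simp
  · intro i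
    rw [hY₀', ← LinearMap.toMatrix_comp, ← LinearMap.toMatrix_comp]
    have h1 : (ψ.symm.toLinearMap ∘ₗ (T i).restrictScalars k) ∘ₗ ψ.toLinearMap =
        Matrix.toLin' (x.1 i) := by
      refine LinearMap.ext fun v => ?_
      change ψ.symm (T i (ψ v)) = _
      rw [hT, ψ.symm_apply_apply]
    rw [h1, LinearMap.toMatrix_eq_toMatrix', LinearMap.toMatrix'_toLin']
  · rw [hM₀]
    simp only [hY₀', ← map_smul, ← map_sum]
    refine congrArg (LinearMap.toMatrix B B) (LinearMap.ext fun v => ?_)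
    obtain ⟨v, rfl⟩ := ψ.surjective v
    have h1 : (∑ i, c i • (T i).restrictScalars k) (ψ v) = (X : k[X]) • ψ v := by
      rw [← hψ, LinearMap.sum_apply]
      simp only [LinearMap.smul_apply, LinearMap.restrictScalars_apply, hT, ← map_smul, ← map_sum]
      simp [N]
    rw [h1]
    obtain ⟨⟨u, v⟩, hu⟩ : ∃ w, w = ψ v := ⟨_, rfl⟩
    rw [← hu]
    obtain ⟨u, rfl⟩ := Ideal.Quotient.mk_surjective u
    obtain ⟨v, rfl⟩ := Ideal.Quotient.mk_surjective v
    refine (pairEnd_mk _ _ _ _ _ _ u v).trans (Prod.ext ?_ ?_)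
    · change mk _ _ = mk _ (X * u)
      simp
    · change mk _ _ = mk _ (X * v)
      simp
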